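/- Let $G$ be a compact (Hausdorff) abelian group with Borel field $\mathscr B_G$ and normalized Haar measure $\lambda_G$, and let $\mathsf P\subset G\times G$ be a correspondence of $G$, i.e. a closed subgroup with $\pi_1(\mathsf P)=\pi_2(\mathsf P)=G$, where $\pi_1,\pi_2$ are the coordinate projections. Let $\lambda_{\mathsf P}$ be the normalized Haar measure of $\mathsf P$ and let $V_{\mathsf P}\colon L^2(G,\mathscr B_G,\lambda_G)\to L^2(G,\mathscr B_G,\lambda_G)$ (complex-valued functions) be the Markov operator determined by $$(V_{\mathsf P}f)\circ\pi_2 = E_{\lambda_{\mathsf P}}\bigl(f\circ\pi_1 \,\big|\, \pi_2^{-1}(\mathscr B_G)\bigr)\quad \lambda_{\mathsf P}\text{-a.e. on } \mathsf P .$$ The polymorphism $\Pi_{\mathsf P}$, which sends $x\in G$ to $\{y:(x,y)\in\mathsf P\}$, is called ergodic if the (almost everywhere) constant functions are the only $f\in L^2(G,\mathscr B_G,\lambda_G)$ with $V_{\mathsf P}f=f$. Then $\Pi_{\mathsf P}$ is nonergodic if and only if there exist a nontrivial character $\chi$ of $G$ (a continuous homomorphism from $G$ to the circle group, not identically $1$)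 and an integer $n\ge 1$ with $V_{\mathsf P}^n\chi=\chi$ in $L^2(G,\mathscr B_G,\lambda_G)$. -/

import Mathlib

open MeasureTheory

/-- The normalized Haar measure of a compact group, as a measure on its Borel field. -/
noncomputable def normalizedHaar (G : Type*) [Group G] [TopologicalSpace G] [IsTopologicalGroup G]
    [CompactSpace G] [MeasurableSpace G] [BorelSpace G] : Measure G :=
  Measure.haarMeasure ⊤

section normalizedHaar

variable (G : Type*) [Group G] [TopologicalSpace G] [IsTopologicalGroup G]
    [CompactSpace G] [MeasurableSpace G] [BorelSpace G]

instance normalizedHaar.instIsHaarMeasure : (normalizedHaar G).IsHaarMeasure :=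
  inferInstanceAs (Measure.haarMeasure (⊤ : TopologicalSpace.PositiveCompacts G)).IsHaarMeasure

instance normalizedHaar.instRegular : (normalizedHaar G).Regular :=
  inferInstanceAs (Measure.haarMeasure (⊤ : TopologicalSpace.PositiveCompacts G)).Regular

instance normalizedHaar.instIsProbabilityMeasure : IsProbabilityMeasure (normalizedHaar G) :=
  ⟨Measure.haarMeasure_self (K₀ := (⊤ : TopologicalSpace.PositiveCompacts G))⟩

end normalizedHaar

/-- A correspondence of `G`: a closed subgroup of `G × G` both of whose coordinate projections
are onto `G`. -/
structure Correspondence (G : Type*) [Group G] [TopologicalSpace G] where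
  toSubgroup : Subgroup (G × G)
  isClosed : IsClosed (toSubgroup : Set (G × G))
  image_fst : Prod.fst '' (toSubgroup : Set (G × G)) = Set.univ
  image_snd : Prod.snd '' (toSubgroup : Set (G × G)) = Set.univ

namespace Correspondence

section Group

variable {G : Type*} [Group G] [TopologicalSpace G]

/-- The underlying compact group of a correspondence. It is a type synonym of the coerced subgroup,
so that it can carry the Borel field of its own (subspace) topology; for a group `G` without a
countable basis the product sigma-algebra could be smaller. -/
def Carrier (P : Correspondence G) : Type _ := P.toSubgroup

variable (P : Correspondence G)

instance instGroupCarrier : Group P.Carrier := inferInstanceAs (Group P.toSubgroup)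

instance instTopologicalSpaceCarrier : TopologicalSpace P.Carrier :=
  inferInstanceAs (TopologicalSpace P.toSubgroup)

instance instIsTopologicalGroupCarrier [IsTopologicalGroup G] : IsTopologicalGroup P.Carrier :=
  inferInstanceAs (IsTopologicalGroup P.toSubgroup)

instance instCompactSpaceCarrier [CompactSpace G] : CompactSpace P.Carrier :=
  isCompact_iff_compactSpace.mp P.isClosed.isCompact

instance instMeasurableSpaceCarrier : MeasurableSpace P.Carrier := borel P.Carrier

instance instBorelSpaceCarrier : BorelSpace P.Carrier := ⟨rfl⟩

/-- The first coordinate projection `π₁ : P → G`. -/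
def proj₁ : P.Carrier →* G := (MonoidHom.fst G G).comp P.toSubgroup.subtype

/-- The second coordinate projection `π₂ : P → G`. -/
def proj₂ : P.Carrier →* G := (MonoidHom.snd G G).comp P.toSubgroup.subtype

theorem continuous_proj₁ : Continuous P.proj₁ := continuous_fst.comp continuous_subtype_val

theorem continuous_proj₂ : Continuous P.proj₂ := continuous_snd.comp continuous_subtype_val

theorem surjective_proj₁ : Function.Surjective P.proj₁ := fun g => by
  obtain ⟨p, hp, rfl⟩ : g ∈ Prod.fst '' (P.toSubgroup : Set (G × G)) := by simp [P.image_fst]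
  exact ⟨⟨p, hp⟩, rfl⟩

theorem surjective_proj₂ : Function.Surjective P.proj₂ := fun g => by
  obtain ⟨p, hp, rfl⟩ : g ∈ Prod.snd '' (P.toSubgroup : Set (G × G)) := by simp [P.image_snd]
  exact ⟨⟨p, hp⟩, rfl⟩

/-- The sigma-algebra `π₂⁻¹(𝓑_G)` on `P`. -/
abbrev sigma₂ [mG : MeasurableSpace G] : MeasurableSpace P.Carrier := mG.comap P.proj₂

variable [MeasurableSpace G] [BorelSpace G]

theorem sigma₂_le : P.sigma₂ ≤ P.instMeasurableSpaceCarrier :=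
  (P.continuous_proj₂.measurable).comap_le

variable [IsTopologicalGroup G] [CompactSpace G]

theorem measurePreserving_proj₁ :
    MeasurePreserving P.proj₁ (normalizedHaar P.Carrier) (normalizedHaar G) :=
  MonoidHom.measurePreserving P.continuous_proj₁ P.surjective_proj₁ (by simp)

theorem measurePreserving_proj₂ :
    MeasurePreserving P.proj₂ (normalizedHaar P.Carrier) (normalizedHaar G) :=
  MonoidHom.measurePreserving P.continuous_proj₂ P.surjective_proj₂ (by simp)

/-- `f ↦ f ∘ π₁`, as an isometry of `L²(G)` into `L²(P)`. -/
noncomputable def lift₁ : Lp ℂ 2 (normalizedHaar G) →ₗᵢ[ℂ] Lp ℂ 2 (normalizedHaar P.Carrier) :=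
  Lp.compMeasurePreservingₗᵢ ℂ P.proj₁ P.measurePreserving_proj₁

/-- `f ↦ f ∘ π₂`, as an isometry of `L²(G)` into `L²(P)`. -/
noncomputable def lift₂ : Lp ℂ 2 (normalizedHaar G) →ₗᵢ[ℂ] Lp ℂ 2 (normalizedHaar P.Carrier) :=
  Lp.compMeasurePreservingₗᵢ ℂ P.proj₂ P.measurePreserving_proj₂

/-- A function in `L²(P)` which is measurable with respect to `π₂⁻¹(𝓑_G)` is of the form `g ∘ π₂`
for some `g ∈ L²(G)`. -/
theorem mem_range_lift₂ (h : lpMeas ℂ ℂ P.sigma₂ 2 (normalizedHaar P.Carrier)) :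
    (h : Lp ℂ 2 (normalizedHaar P.Carrier)) ∈ LinearMap.range P.lift₂.toLinearMap := by
  obtain ⟨k, hk, hhk⟩ := lpMeas.aestronglyMeasurable h
  obtain ⟨g, hg, rfl⟩ := hk.exists_eq_measurable_comp
  have hgL : MemLp g 2 (normalizedHaar G) := by
    have h1 : MemLp (g ∘ P.proj₂) 2 (normalizedHaar P.Carrier) :=
      (memLp_congr_ae hhk).mp (Lp.memLp _)
    have h2 := P.measurePreserving_proj₂
    rw [← h2.map_eq]
    exact (memLp_map_measure_iff hg.aestronglyMeasurable h2.aemeasurable).mpr h1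
  refine ⟨hgL.toLp g, Lp.ext ?_⟩
  refine (Lp.coeFn_compMeasurePreserving _ P.measurePreserving_proj₂).trans
    (Filter.EventuallyEq.trans ?_ hhk.symm)
  exact P.measurePreserving_proj₂.quasiMeasurePreserving.ae_eq_comp hgL.coeFn_toLp

/-- The Markov operator `V_P` on `L²(G)`: `V_P f = E(f ∘ π₁ | π₂⁻¹(𝓑_G))`, the expectation being
conditional with respect to the Haar measure of `P`, and `π₂⁻¹(𝓑_G)`-measurable functions
`g ∘ π₂` on `P` being identified with the functions `g` on `G`. -/
noncomputable def markovOperator :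
    Lp ℂ 2 (normalizedHaar G) →L[ℂ] Lp ℂ 2 (normalizedHaar G) :=
  (P.lift₂.equivRange.symm : _ →L[ℂ] Lp ℂ 2 (normalizedHaar G)) ∘L
    (((lpMeas ℂ ℂ P.sigma₂ 2 (normalizedHaar P.Carrier)).subtypeL).codRestrict
      (LinearMap.range P.lift₂.toLinearMap) P.mem_range_lift₂) ∘L
    (condExpL2 ℂ ℂ P.sigma₂_le) ∘L P.lift₁.toContinuousLinearMap

/-- The defining property of the Markov operator in terms of the conditional expectation of
functions. -/
theorem markovOperator_spec (f : Lp ℂ 2 (normalizedHaar G)) :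
    (P.markovOperator f : G → ℂ) ∘ P.proj₂ =ᵐ[normalizedHaar P.Carrier]
      (normalizedHaar P.Carrier)[(f : G → ℂ) ∘ P.proj₁ | P.sigma₂] := by
  have h1 : P.lift₂ (P.markovOperator f) = condExpL2 ℂ ℂ P.sigma₂_le (P.lift₁ f) := by
    have := LinearIsometryEquiv.apply_symm_apply P.lift₂.equivRange
      ⟨(condExpL2 ℂ ℂ P.sigma₂_le (P.lift₁ f) : Lp ℂ 2 (normalizedHaar P.Carrier)),
        P.mem_range_lift₂ _⟩
    exact congrArg Subtype.val this
  have h2 := Lp.coeFn_compMeasurePreserving (P.markovOperator f) P.measurePreserving_proj₂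
  have h3 : MemLp ((f : G → ℂ) ∘ P.proj₁) 2 (normalizedHaar P.Carrier) :=
    (Lp.memLp f).comp_measurePreserving P.measurePreserving_proj₁
  have h4 : P.lift₁ f = h3.toLp := Lp.ext
    ((Lp.coeFn_compMeasurePreserving f P.measurePreserving_proj₁).trans h3.coeFn_toLp.symm)
  refine h2.symm.trans ?_
  change (P.lift₂ (P.markovOperator f) : P.Carrier → ℂ) =ᵐ[_] _
  rw [h1, h4]
  exact h3.condExpL2_ae_eq_condExp P.sigma₂_le

/-- The polymorphism `Π_P` is ergodic if the constants are the only `V_P`-invariant functions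
in `L²(G)`. -/
def IsErgodic : Prop :=
  ∀ f : Lp ℂ 2 (normalizedHaar G), P.markovOperator f = f →
    ∃ c : ℂ, (f : G → ℂ) =ᵐ[normalizedHaar G] fun _ => c

end Group

end Correspondence

/-- A character of `G` (a continuous homomorphism into the circle group), regarded as an element
of `L²(G)`. -/
noncomputable def characterToL2 {G : Type*} [Group G] [TopologicalSpace G] [IsTopologicalGroup G]
    [CompactSpace G] [MeasurableSpace G] [BorelSpace G] (χ : G →ₜ* Circle) :
    Lp ℂ 2 (normalizedHaar G) :=
  ContinuousMap.toLp 2 (normalizedHaar G) ℂ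
    (⟨fun g => (χ g : ℂ), continuous_subtype_val.comp χ.continuous_toFun⟩ : C(G, ℂ))

/-!
Write `V` for the Markov operator. It satisfies `⟪h, V f⟫ = ⟪h ∘ π₂, f ∘ π₁⟫` in `L²(P)`
(`Correspondence.inner_markovOperator`). The functions `χ ∘ π₁` and `ψ ∘ π₂`, for characters `χ`, `ψ`
of `G`, are characters of `P`. If `χ ∘ π₁` is trivial on the kernel of `π₂`, it equals `ψ ∘ π₂` for a
character `ψ`, and `V χ = ψ`; otherwise it is orthogonal to every `h ∘ π₂`, and `V χ = 0`. With the
projections exchanged, the same dichotomy describes the adjoint of `V`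
(`exists_character_or_inner_eq_zero`).

If `V ^ n χ = χ` for a nontrivial `χ`, then `∑ k < n, V ^ k χ` is invariant, and it is not constant as
its inner product with `χ` is at least `1` (`Correspondence.not_isErgodic_of_periodic`).

Conversely, an invariant `f` that is not constant has a nonzero Fourier coefficient at some nontrivial
character `ψ`. As `⟪ψ, V f⟫ = ⟪ψ, f⟫ ≠ 0`, there is a character `χ` with `V χ = ψ` and
`⟪χ, f⟫ = ⟪ψ, f⟫`. Iterating gives an infinite backward orbit of characters with the same Fourier
coefficient, so by Bessel's inequality a character occurs in it twice and hence is periodic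
(`Correspondence.exists_periodic_of_inner_ne_zero`).

The analytic ingredient is that the characters of a compact abelian group are complete in `L²(G)`
(`eq_zero_of_forall_inner_characterToL2`). Convolution with a hermitian continuous function is a
compact self-adjoint operator commuting with translations. Its eigenspaces for nonzero eigenvalues
are finite-dimensional, so the commuting unitary translations are simultaneously diagonalizable on
them, and a common eigenvector is a multiple of a character. By the spectral theorem a function
orthogonal to all characters is annihilated by all these convolutions, and so is orthogonal to all
continuous functions.
-/

open scoped InnerProductSpace ComplexConjugate

/-! ### Simultaneous diagonalization of unitary operators -/

/-- A linear map preserving inner products on a finite-dimensional space is semisimple: the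
orthogonal complement of an invariant subspace is invariant. -/
theorem Module.End.isSemisimple_of_inner_map_map {E : Type*} [NormedAddCommGroup E]
    [InnerProductSpace ℂ E] [FiniteDimensional ℂ E] (U : Module.End ℂ E)
    (hU : ∀ x y, ⟪U x, U y⟫_ℂ = ⟪x, y⟫_ℂ) : U.IsSemisimple := by
  refine Module.End.isSemisimple_iff.mpr fun p hp => ⟨pᗮ, ?_,
    Submodule.isCompl_orthogonal _⟩
  have hp' : ∀ x ∈ p, U x ∈ p := hp
  have hinj : Function.Injective U := by
    refine (injective_iff_map_eq_zero U).mpr fun x hx => ?_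
    rw [← inner_self_eq_zero (𝕜 := ℂ), ← hU, hx, inner_zero_left]
  have hsurj : Function.Surjective (U.restrict hp') :=
    LinearMap.injective_iff_surjective.mp fun x y hxy => Subtype.ext (hinj congr($hxy))
  intro v hv x hx
  obtain ⟨y, hy⟩ := hsurj ⟨x, hx⟩
  have hy' : U y = x := congr($hy)
  rw [← hy', hU]
  exact hv y y.2

/-- Commuting unitary operators on a finite-dimensional space can be diagonalized
simultaneously. -/
theorem Module.End.iSup_iInf_eigenspace_eq_top_of_inner_map_map {ι E : Type*}
    [NormedAddCommGroup E] [InnerProductSpace ℂ E] [FiniteDimensional ℂ E] (U : ι → Module.End ℂ E)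
    (hU : ∀ i x y, ⟪U i x, U i y⟫_ℂ = ⟪x, y⟫_ℂ) (hcomm : Pairwise fun i j => Commute (U i) (U j)) :
    ⨆ c : ι → ℂ, ⨅ i, (U i).eigenspace (c i) = ⊤ := by
  rw [← Module.End.iSup_iInf_maxGenEigenspace_eq_top_of_iSup_maxGenEigenspace_eq_top_of_commute U
    hcomm fun i => (U i).iSup_maxGenEigenspace_eq_top]
  refine iSup_congr fun c => iInf_congr fun i => ?_
  exact ((Module.End.isSemisimple_of_inner_map_map _
    (hU i)).isFinitelySemisimple.maxGenEigenspace_eq_eigenspace _).symm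

/-! ### Compactness of integral operators with continuous kernel -/

section InnerKernel

variable {X H : Type*} [TopologicalSpace X] [CompactSpace X] [NormedAddCommGroup H]
  [InnerProductSpace ℂ H]

/-- The operator `H → C(X)` sending `f` to the function `x ↦ ⟪κ x, f⟫`, for a continuous family `κ`
of vectors of `H`. -/
noncomputable def innerKernel (κ : C(X, H)) : H →L[ℂ] C(X, ℂ) :=
  LinearMap.mkContinuous
    { toFun := fun f => ⟨fun x => ⟪κ x, f⟫_ℂ, by fun_prop⟩
      map_add' := fun f g => by ext x; simp
      map_smul' := fun c f => by ext x; simp } ‖κ‖ fun f => by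
    refine (ContinuousMap.norm_le _ (by positivity)).mpr fun x => ?_
    exact (norm_inner_le_norm _ _).trans (by gcongr; exact κ.norm_coe_le_norm x)

@[simp]
theorem innerKernel_apply (κ : C(X, H)) (f : H) (x : X) : innerKernel κ f x = ⟪κ x, f⟫_ℂ := rfl

/-- By Arzelà–Ascoli: the image of the unit ball is bounded, and it is equicontinuous because `κ`
is continuous in norm. -/
theorem isCompactOperator_innerKernel (κ : C(X, H)) : IsCompactOperator (innerKernel κ) := by
  let e := ContinuousMap.equivBoundedOfCompact X ℂ
  let A : Set (BoundedContinuousFunction X ℂ) := e '' (innerKernel κ '' Metric.ball 0 1)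
  have hA : IsCompact (closure A) := by
    refine BoundedContinuousFunction.arzela_ascoli (Metric.closedBall 0 ‖κ‖)
      (isCompact_closedBall _ _) A ?_ ?_
    · rintro _ x ⟨_, ⟨f, hf, rfl⟩, rfl⟩
      have hf' : ‖f‖ ≤ 1 := by simpa using (mem_ball_zero_iff.mp hf).le
      simp only [mem_closedBall_zero_iff]
      calc ‖⟪κ x, f⟫_ℂ‖ ≤ ‖κ x‖ * ‖f‖ := norm_inner_le_norm _ _
        _ ≤ ‖κ‖ * 1 := by gcongr; exact κ.norm_coe_le_norm x
        _ = ‖κ‖ := mul_one _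
    · intro x
      rw [Metric.equicontinuousAt_iff_right]
      intro ε hε
      obtain ⟨U, hU, hxU⟩ : ∃ U ∈ nhds x, ∀ y ∈ U, dist (κ y) (κ x) < ε :=
        ⟨_, κ.continuous.continuousAt (Metric.ball_mem_nhds _ hε), fun y hy => hy⟩
      filter_upwards [hU] with y hy
      rintro ⟨_, _, ⟨f, hf, rfl⟩, rfl⟩
      have hf' : ‖f‖ ≤ 1 := by simpa using (mem_ball_zero_iff.mp hf).le
      change dist ⟪κ x, f⟫_ℂ ⟪κ y, f⟫_ℂ < ε
      rw [dist_comm, dist_eq_norm, ← inner_sub_left]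
      refine lt_of_le_of_lt ((norm_inner_le_norm _ _).trans
        (mul_le_of_le_one_right (norm_nonneg _) hf')) ?_
      rw [← dist_eq_norm]
      exact hxU y hy
  refine ⟨e.symm '' closure A, hA.image ?_, ?_⟩
  · exact (ContinuousMap.isometryEquivBoundedOfCompact X ℂ).symm.continuous
  · filter_upwards [Metric.ball_mem_nhds (0 : H) one_pos] with f hf
    exact ⟨e (innerKernel κ f), subset_closure ⟨_, ⟨f, hf, rfl⟩, rfl⟩, e.symm_apply_apply _⟩

end InnerKernel

/-! ### Characters and translations in `L²(G)` -/

section Translation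

variable {G : Type*} [Group G] [TopologicalSpace G] [IsTopologicalGroup G]
    [CompactSpace G] [MeasurableSpace G] [BorelSpace G]

/-- If `F (q * p) = c * F p` for some `q` and some `c ≠ 1`, then translation invariance of the Haar
measure makes the integral of `F` vanish. -/
theorem integral_eq_zero_of_translate {F : G → ℂ} {q : G} {c : ℂ} (hc : c ≠ 1)
    (hF : ∀ p, F (q * p) = c * F p) : ∫ p, F p ∂normalizedHaar G = 0 := by
  have h := integral_mul_left_eq_self (μ := normalizedHaar G) F q
  simp_rw [hF, integral_const_mul] at h
  have h' : (c - 1) * ∫ p, F p ∂normalizedHaar G = 0 := by linear_combination h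
  exact (mul_eq_zero.mp h').resolve_left (sub_ne_zero.mpr hc)

theorem characterToL2_ae_eq (χ : G →ₜ* Circle) :
    (characterToL2 χ : G → ℂ) =ᵐ[normalizedHaar G] fun g => (χ g : ℂ) :=
  ContinuousMap.coeFn_toLp _ _

/-- For distinct characters, `conj χ * ψ` is an eigenfunction of some translation with eigenvalue
other than `1`, so its integral vanishes. -/
theorem orthonormal_characterToL2 :
    Orthonormal ℂ (characterToL2 : (G →ₜ* Circle) → Lp ℂ 2 (normalizedHaar G)) := by
  classical
  rw [orthonormal_iff_ite]
  intro χ ψ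
  rw [characterToL2, characterToL2, ContinuousMap.inner_toLp]
  split_ifs with h
  · subst h
    simp [Complex.mul_conj, Circle.normSq_coe]
  · obtain ⟨g, hg⟩ : ∃ g, χ g ≠ ψ g := by
      by_contra! hall
      exact h (ContinuousMonoidHom.ext hall)
    refine integral_eq_zero_of_translate (q := g) (c := (ψ g * (χ g)⁻¹ : Circle)) ?_ fun p => ?_
    · rw [Ne, Circle.coe_eq_one, mul_inv_eq_one]
      exact fun h => hg h.symm
    · simp only [ContinuousMap.coe_mk, map_mul, Circle.coe_mul, Circle.coe_inv_eq_conj]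
      ring

/-- Left translation `f ↦ f (g * ·)` on `L²(G)`. -/
noncomputable def translateL2 (g : G) :
    Lp ℂ 2 (normalizedHaar G) →ₗᵢ[ℂ] Lp ℂ 2 (normalizedHaar G) :=
  Lp.compMeasurePreservingₗᵢ ℂ (g * ·) (measurePreserving_mul_left _ g)

theorem translateL2_toLp (g : G) (f : C(G, ℂ)) :
    translateL2 g (ContinuousMap.toLp 2 (normalizedHaar G) ℂ f) =
      ContinuousMap.toLp 2 (normalizedHaar G) ℂ (f.comp ⟨(g * ·), by fun_prop⟩) := by
  refine Lp.ext ?_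
  refine (Lp.coeFn_compMeasurePreserving _ (measurePreserving_mul_left _ g)).trans ?_
  refine Filter.EventuallyEq.trans ?_ (ContinuousMap.coeFn_toLp _ _).symm
  exact (measurePreserving_mul_left (normalizedHaar G) g).quasiMeasurePreserving.ae_eq_comp
    (ContinuousMap.coeFn_toLp _ _)

theorem translateL2_translateL2 (g h : G) (f : Lp ℂ 2 (normalizedHaar G)) :
    translateL2 g (translateL2 h f) = translateL2 (h * g) f := by
  refine Lp.ext ?_
  have h1 := Lp.coeFn_compMeasurePreserving f (measurePreserving_mul_left (normalizedHaar G) h)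
  have h2 := Lp.coeFn_compMeasurePreserving (translateL2 h f)
    (measurePreserving_mul_left (normalizedHaar G) g)
  have h3 := Lp.coeFn_compMeasurePreserving f
    (measurePreserving_mul_left (normalizedHaar G) (h * g))
  refine h2.trans (Filter.EventuallyEq.trans ((measurePreserving_mul_left (normalizedHaar G)
    g).quasiMeasurePreserving.ae_eq_comp h1) (Filter.EventuallyEq.trans ?_ h3.symm))
  exact .of_forall fun x => by simp [Function.comp, mul_assoc]

end Translation

/-! ### Convolution operators and their eigenvectors -/

section Convolution

variable {G : Type*} [Group G] [TopologicalSpace G] [IsTopologicalGroup G]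
    [CompactSpace G] [MeasurableSpace G] [BorelSpace G]

/-- The continuous family `x ↦ k (x⁻¹ * ·)` of elements of `L²(G)`. -/
noncomputable def translates (k : C(G, ℂ)) : C(G, Lp ℂ 2 (normalizedHaar G)) :=
  ⟨fun x => ContinuousMap.toLp 2 (normalizedHaar G) ℂ
      ((⟨fun p : G × G => k (p.1⁻¹ * p.2), by fun_prop⟩ : C(G × G, ℂ)).curry x),
    (ContinuousMap.toLp 2 (normalizedHaar G) ℂ).continuous.comp (ContinuousMap.continuous _)⟩

theorem translateL2_translates (k : C(G, ℂ)) (g x : G) :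
    translateL2 g (translates k (g * x)) = translates k x := by
  change translateL2 g (ContinuousMap.toLp 2 (normalizedHaar G) ℂ _) = _
  rw [translateL2_toLp]
  change _ = ContinuousMap.toLp 2 (normalizedHaar G) ℂ _
  congr 1
  ext y
  simp [mul_assoc]

/-- The convolution operator `f ↦ (x ↦ ⟪k (x⁻¹ * ·), f⟫)` on `L²(G)`. -/
noncomputable def convolutionL2 (k : C(G, ℂ)) :
    Lp ℂ 2 (normalizedHaar G) →L[ℂ] Lp ℂ 2 (normalizedHaar G) :=
  ContinuousMap.toLp 2 (normalizedHaar G) ℂ ∘L innerKernel (translates k)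

theorem isCompactOperator_convolutionL2 (k : C(G, ℂ)) : IsCompactOperator (convolutionL2 k) :=
  (isCompactOperator_innerKernel (translates k)).clm_comp
    (ContinuousMap.toLp 2 (normalizedHaar G) ℂ)

theorem innerKernel_translates_translateL2 (k : C(G, ℂ)) (g x : G)
    (f : Lp ℂ 2 (normalizedHaar G)) :
    innerKernel (translates k) (translateL2 g f) x = innerKernel (translates k) f (g * x) := by
  rw [innerKernel_apply, innerKernel_apply, ← translateL2_translates k g x,
    LinearIsometry.inner_map_map]

theorem convolutionL2_translateL2 (k : C(G, ℂ)) (g : G) (f : Lp ℂ 2 (normalizedHaar G)) :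
    convolutionL2 k (translateL2 g f) = translateL2 g (convolutionL2 k f) := by
  change ContinuousMap.toLp 2 (normalizedHaar G) ℂ _ =
    translateL2 g (ContinuousMap.toLp 2 (normalizedHaar G) ℂ _)
  rw [translateL2_toLp]
  congr 1
  ext x
  exact innerKernel_translates_translateL2 k g x f

/-- An `L²` function which is an eigenvector of all translations and of a convolution operator, the
latter with a nonzero eigenvalue, is a multiple of a character: it has a continuous representative
`φ`, and `φ (g * x) = c g * φ x` holds everywhere. -/
theorem mem_span_characterToL2_of_eigenvector {k : C(G, ℂ)} {v : Lp ℂ 2 (normalizedHaar G)}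
    {l : ℂ} (hl : l ≠ 0) (hv : convolutionL2 k v = l • v) {c : G → ℂ}
    (hc : ∀ g, translateL2 g v = c g • v) :
    v ∈ Submodule.span ℂ (Set.range (characterToL2 : (G →ₜ* Circle) → _)) := by
  by_cases hv0 : v = 0
  · simp [hv0]
  let φ : C(G, ℂ) := l⁻¹ • innerKernel (translates k) v
  have hφv : ContinuousMap.toLp 2 (normalizedHaar G) ℂ φ = v := by
    rw [map_smul]
    change l⁻¹ • convolutionL2 k v = v
    rw [hv, smul_smul, inv_mul_cancel₀ hl, one_smul]
  have hφ : ∀ g x, φ (g * x) = c g * φ x := by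
    intro g x
    have h1 := innerKernel_translates_translateL2 k g x v
    rw [hc, map_smul] at h1
    simp only [φ, ContinuousMap.smul_apply, smul_eq_mul] at h1 ⊢
    rw [← h1]
    ring
  have hφ1 : ∀ g, φ g = c g * φ 1 := fun g => by rw [← hφ, mul_one]
  have hφ0 : φ 1 ≠ 0 := by
    intro h0
    apply hv0
    rw [← hφv, show φ = 0 from ContinuousMap.ext fun g => by rw [hφ1, h0, mul_zero]; rfl, map_zero]
  have hcnorm : ∀ g, ‖c g‖ = 1 := fun g => by
    have h1 := (translateL2 g).norm_map v
    rw [hc, norm_smul] at h1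
    exact mul_right_cancel₀ (norm_ne_zero_iff.mpr hv0) (h1.trans (one_mul _).symm)
  have hcφ : c = fun g => φ g / φ 1 := funext fun g => by rw [hφ1, mul_div_cancel_right₀ _ hφ0]
  have hcmul : ∀ g h, c (g * h) = c g * c h := fun g h => by
    apply mul_right_cancel₀ hφ0
    rw [← hφ1, hφ, hφ1, mul_assoc]
  have hccont : Continuous c := by rw [hcφ]; fun_prop
  let χ : G →ₜ* Circle :=
    { toMonoidHom := MonoidHom.mk' (fun g => ⟨c g, mem_sphere_zero_iff_norm.mpr (hcnorm g)⟩)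
        fun g h => Circle.ext (hcmul g h)
      continuous_toFun := hccont.subtype_mk _ }
  have hvχ : v = φ 1 • characterToL2 χ := by
    rw [← hφv, characterToL2, ← map_smul]
    congr 1
    ext g
    rw [hφ1, mul_comm]
    rfl
  rw [hvχ]
  exact Submodule.smul_mem _ _ (Submodule.subset_span ⟨χ, rfl⟩)

variable [T2Space G]

theorem denseRange_toLp :
    DenseRange (ContinuousMap.toLp 2 (normalizedHaar G) ℂ : C(G, ℂ) →L[ℂ] _) :=
  ContinuousMap.toLp_denseRange ℂ _ ℂ (by norm_num)

/-- For a hermitian function `k`, that is `k x⁻¹ = conj (k x)`, the integral kernel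
`conj (k (x⁻¹ * y))` is hermitian. Fubini's theorem is only needed for continuous functions, as
these are dense in `L²(G)`. -/
theorem isSymmetric_convolutionL2 {k : C(G, ℂ)} (hk : ∀ x, k x⁻¹ = conj (k x)) :
    (convolutionL2 k).IsSymmetric := by
  intro f h
  change ⟪convolutionL2 k f, h⟫_ℂ = ⟪f, convolutionL2 k h⟫_ℂ
  refine denseRange_toLp.induction_on₂
    (p := fun f h => ⟪convolutionL2 k f, h⟫_ℂ = ⟪f, convolutionL2 k h⟫_ℂ)
    (isClosed_eq (by fun_prop) (by fun_prop)) (fun a b => ?_) f h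
  have hA : ∀ (a : C(G, ℂ)) (x : G),
      innerKernel (translates k) (ContinuousMap.toLp 2 (normalizedHaar G) ℂ a) x =
        ∫ y, a y * conj (k (x⁻¹ * y)) ∂normalizedHaar G := fun a x =>
    ContinuousMap.inner_toLp (normalizedHaar G) _ _
  change ⟪ContinuousMap.toLp 2 (normalizedHaar G) ℂ (innerKernel (translates k) _), _⟫_ℂ =
    ⟪_, ContinuousMap.toLp 2 (normalizedHaar G) ℂ (innerKernel (translates k) _)⟫_ℂ
  rw [ContinuousMap.inner_toLp, ContinuousMap.inner_toLp]
  simp_rw [hA, ← integral_conj, ← integral_const_mul, ← integral_mul_const]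
  rw [integral_integral_swap_of_hasCompactSupport
    (by simp only [Function.uncurry_def]; fun_prop) (HasCompactSupport.of_compactSpace _)]
  refine integral_congr_ae (.of_forall fun y => integral_congr_ae (.of_forall fun x => ?_))
  have h1 : k (x⁻¹ * y) = conj (k (y⁻¹ * x)) := by rw [← hk]; simp
  simp only [map_mul, Complex.conj_conj, h1]
  ring

end Convolution

/-! ### Completeness of the characters of a compact abelian group -/

section Completeness

variable {G : Type*} [CommGroup G] [TopologicalSpace G] [IsTopologicalGroup G]
    [CompactSpace G] [MeasurableSpace G] [BorelSpace G]

/-- The eigenspace is finite-dimensional and invariant under the commuting unitary translations,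
which can therefore be diagonalized simultaneously on it. -/
theorem eigenspace_convolutionL2_le_span (k : C(G, ℂ)) {l : ℂ} (hl : l ≠ 0) :
    Module.End.eigenspace (convolutionL2 k).toLinearMap l ≤
      Submodule.span ℂ (Set.range (characterToL2 : (G →ₜ* Circle) → _)) := by
  set E := Module.End.eigenspace (convolutionL2 k).toLinearMap l with hE
  set W := Submodule.span ℂ
    (Set.range (characterToL2 : (G →ₜ* Circle) → Lp ℂ 2 (normalizedHaar G)))
  have : FiniteDimensional ℂ E := ContinuousLinearMap.finite_dimensional_eigenspace
    (isCompactOperator_convolutionL2 k) l hl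
  have hmem : ∀ {v}, v ∈ E ↔ convolutionL2 k v = l • v := Module.End.mem_eigenspace_iff
  have hinv : ∀ g, ∀ v ∈ E, (translateL2 g).toLinearMap v ∈ E := fun g v hv => by
    change translateL2 g v ∈ E
    rw [hmem, convolutionL2_translateL2, hmem.mp hv, map_smul]
  let U : G → Module.End ℂ E := fun g => (translateL2 g).toLinearMap.restrict (hinv g)
  have htop := Module.End.iSup_iInf_eigenspace_eq_top_of_inner_map_map U
    (fun g x y => (translateL2 g).inner_map_map x y) fun g h _ => by
      refine LinearMap.ext fun v => Subtype.ext ?_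
      change translateL2 g (translateL2 h v) = translateL2 h (translateL2 g v)
      rw [translateL2_translateL2, translateL2_translateL2, mul_comm]
  have hle : (⊤ : Submodule ℂ E) ≤ W.comap E.subtype := by
    rw [← htop]
    refine iSup_le fun c v hv => ?_
    refine mem_span_characterToL2_of_eigenvector hl (hmem.mp v.2) (c := c) fun g => ?_
    have h1 := Module.End.mem_eigenspace_iff.mp ((Submodule.mem_iInf _).mp hv g)
    exact congr($h1)
  exact fun v hv => hle (Submodule.mem_top (x := (⟨v, hv⟩ : E)))

variable [T2Space G]

/-- An element of `L²(G)` orthogonal to all characters is orthogonal to the eigenspaces of a hermitian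
convolution operator with nonzero eigenvalue, so by the spectral theorem the operator kills it. -/
theorem convolutionL2_eq_zero {k : C(G, ℂ)} (hk : ∀ x, k x⁻¹ = conj (k x))
    {f : Lp ℂ 2 (normalizedHaar G)} (hf : ∀ χ : G →ₜ* Circle, ⟪characterToL2 χ, f⟫_ℂ = 0) :
    convolutionL2 k f = 0 := by
  have hsymm := isSymmetric_convolutionL2 hk
  have hfW : f ∈ (Submodule.span ℂ (Set.range (characterToL2 : (G →ₜ* Circle) → _)))ᗮ := by
    rw [Submodule.mem_orthogonal]
    intro u hu
    induction hu using Submodule.span_induction with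
    | mem u hu => obtain ⟨χ, rfl⟩ := hu; exact hf χ
    | zero => simp
    | add u w _ _ hu hw => rw [inner_add_left, hu, hw, add_zero]
    | smul a u _ hu => rw [inner_smul_left, hu, mul_zero]
  have h := ContinuousLinearMap.orthogonalComplement_iSup_eigenspaces_eq_bot
    (isCompactOperator_convolutionL2 k) hsymm
  rw [← Submodule.mem_bot ℂ, ← h, ← Submodule.iInf_orthogonal, Submodule.mem_iInf]
  intro l e he
  have he' : convolutionL2 k e = l • e := Module.End.mem_eigenspace_iff.mp he
  have h1 : ⟪e, convolutionL2 k f⟫_ℂ = conj l * ⟪e, f⟫_ℂ := by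
    rw [← inner_smul_left, ← he']
    exact (hsymm e f).symm
  rw [h1]
  by_cases hl : l = 0
  · simp [hl]
  · rw [hfW e (eigenspace_convolutionL2_le_span k hl he), mul_zero]

/-- The convolution of `f` with `k` is a continuous function which vanishes almost everywhere, hence
everywhere; its value at `1` is the inner product of `k` and `f`. -/
theorem inner_toLp_eq_zero_of_hermitian {k : C(G, ℂ)} (hk : ∀ x, k x⁻¹ = conj (k x))
    {f : Lp ℂ 2 (normalizedHaar G)} (hf : ∀ χ : G →ₜ* Circle, ⟪characterToL2 χ, f⟫_ℂ = 0) :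
    ⟪ContinuousMap.toLp 2 (normalizedHaar G) ℂ k, f⟫_ℂ = 0 := by
  have h0 : innerKernel (translates k) f = 0 := by
    refine ContinuousMap.toLp_injective (p := 2) (𝕜 := ℂ) (normalizedHaar G) ?_
    rw [map_zero]
    exact convolutionL2_eq_zero hk hf
  have h1 : ContinuousMap.toLp 2 (normalizedHaar G) ℂ k = translates k 1 := by
    change _ = ContinuousMap.toLp 2 (normalizedHaar G) ℂ _
    congr 1
    ext y
    simp
  rw [h1, ← innerKernel_apply, h0, ContinuousMap.zero_apply]

/-- The characters of a compact abelian group are complete in `L²(G)`. -/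
theorem eq_zero_of_forall_inner_characterToL2 {f : Lp ℂ 2 (normalizedHaar G)}
    (hf : ∀ χ : G →ₜ* Circle, ⟪characterToL2 χ, f⟫_ℂ = 0) : f = 0 := by
  refine denseRange_toLp.eq_zero_of_inner_right ℂ fun u => ?_
  -- Every continuous function is a complex combination of two hermitian ones.
  let v : C(G, ℂ) := ⟨fun x => conj (u x⁻¹), by fun_prop⟩
  have h1 := inner_toLp_eq_zero_of_hermitian (k := u + v) (fun x => by simp [v, add_comm]) hf
  have h2 := inner_toLp_eq_zero_of_hermitian (k := Complex.I • (u - v)) (fun x => by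
    simp [v]; ring) hf
  rw [map_smul, inner_smul_left, map_sub, inner_sub_left] at h2
  rw [map_add, inner_add_left] at h1
  have h3 := (mul_eq_zero.mp h2).resolve_left (by simp)
  linear_combination (h1 + h3) / 2

end Completeness

/-! ### Characters along a pair of surjections -/

section Projections

variable {G Q : Type*} [Group G] [TopologicalSpace G] [Group Q] [TopologicalSpace Q]
    [CompactSpace Q]

/-- A character of a compact group which is trivial on the kernel of a surjection descends to the
quotient. -/
theorem exists_character_comp_eq [T2Space G] (χ : Q →ₜ* Circle) {β : Q →* G} (hβ : Continuous β)
    (hβs : Function.Surjective β) (h : ∀ q, β q = 1 → χ q = 1) :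
    ∃ ψ : G →ₜ* Circle, ∀ q, ψ (β q) = χ q := by
  let ψ : G →* Circle := MonoidHom.liftOfSurjective β hβs ⟨χ.toMonoidHom, fun q hq => h q hq⟩
  have hψ : ∀ q, ψ (β q) = χ q := fun q =>
    MonoidHom.liftOfRightInverse_comp_apply β _ (Function.rightInverse_surjInv hβs)
      ⟨χ.toMonoidHom, fun q hq => h q hq⟩ q
  refine ⟨⟨ψ, ?_⟩, hψ⟩
  refine (hβ.isClosedMap.isQuotientMap hβ hβs).continuous_iff.mpr ?_
  exact χ.continuous_toFun.congr fun q => (hψ q).symm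

variable [IsTopologicalGroup G] [CompactSpace G] [MeasurableSpace G] [BorelSpace G]
    [IsTopologicalGroup Q] [MeasurableSpace Q] [BorelSpace Q]

theorem compMeasurePreserving_characterToL2_ae_eq {α : Q →* G}
    (hα : MeasurePreserving α (normalizedHaar Q) (normalizedHaar G)) (χ : G →ₜ* Circle) :
    (Lp.compMeasurePreservingₗᵢ ℂ α hα (characterToL2 χ) : Q → ℂ) =ᵐ[normalizedHaar Q]
      fun q => (χ (α q) : ℂ) := by
  have h1 := Lp.coeFn_compMeasurePreserving (characterToL2 χ) hα
  have h2 := hα.quasiMeasurePreserving.ae_eq_comp (characterToL2_ae_eq χ)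
  exact h1.trans h2

/-- Let `α, β : Q → G` be surjections of compact groups. A character of `G` pulled back along `α`
either is also the pullback of a character along `β`, or it is orthogonal to all pullbacks along
`β`, since it is nontrivial on some element of the kernel of `β`. -/
theorem exists_character_or_inner_eq_zero [T2Space G] {α β : Q →* G} (hα : Continuous α)
    (hβ : Continuous β) (hβs : Function.Surjective β)
    (hαm : MeasurePreserving α (normalizedHaar Q) (normalizedHaar G))
    (hβm : MeasurePreserving β (normalizedHaar Q) (normalizedHaar G)) (χ : G →ₜ* Circle) :
    (∃ ψ : G →ₜ* Circle, Lp.compMeasurePreservingₗᵢ ℂ α hαm (characterToL2 χ) =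
        Lp.compMeasurePreservingₗᵢ ℂ β hβm (characterToL2 ψ)) ∨
      ∀ f : Lp ℂ 2 (normalizedHaar G), ⟪Lp.compMeasurePreservingₗᵢ ℂ β hβm f,
        Lp.compMeasurePreservingₗᵢ ℂ α hαm (characterToL2 χ)⟫_ℂ = 0 := by
  by_cases h : ∀ q, β q = 1 → χ (α q) = 1
  · left
    obtain ⟨ψ, hψ⟩ := exists_character_comp_eq (χ.comp ⟨α, hα⟩) hβ hβs h
    refine ⟨ψ, Lp.ext ((compMeasurePreserving_characterToL2_ae_eq hαm χ).trans
      (Filter.EventuallyEq.trans (.of_forall fun q => ?_)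
        (compMeasurePreserving_characterToL2_ae_eq hβm ψ).symm))⟩
    exact congrArg _ (hψ q).symm
  · right
    intro f
    push Not at h
    obtain ⟨q, hq, hχq⟩ := h
    have hae : (fun p => ⟪Lp.compMeasurePreservingₗᵢ ℂ β hβm f p,
        Lp.compMeasurePreservingₗᵢ ℂ α hαm (characterToL2 χ) p⟫_ℂ) =ᵐ[normalizedHaar Q]
        fun p => (χ (α p) : ℂ) * conj (f (β p)) := by
      filter_upwards [Lp.coeFn_compMeasurePreserving f hβm,
        compMeasurePreserving_characterToL2_ae_eq hαm χ] with p h1 h2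
      rw [h2, RCLike.inner_apply]
      exact congrArg (fun z => (χ (α p) : ℂ) * conj z) h1
    rw [L2.inner_def, integral_congr_ae hae]
    refine integral_eq_zero_of_translate (q := q) (c := (χ (α q) : ℂ)) ?_ fun p => ?_
    · rwa [Ne, Circle.coe_eq_one]
    · rw [map_mul, map_mul, map_mul, hq, one_mul, Circle.coe_mul, mul_assoc]

end Projections

/-! ### The Markov operator on characters -/

namespace Correspondence

variable {G : Type*} [Group G] [TopologicalSpace G] [IsTopologicalGroup G] [CompactSpace G]
  [MeasurableSpace G] [BorelSpace G] (P : Correspondence G)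

/-- The matrix coefficients of the Markov operator: conditional expectation drops out when paired
with a function measurable with respect to the second coordinate. -/
theorem inner_markovOperator (h f : Lp ℂ 2 (normalizedHaar G)) :
    ⟪h, P.markovOperator f⟫_ℂ = ⟪P.lift₂ h, P.lift₁ f⟫_ℂ := by
  have h1 : P.lift₂ (P.markovOperator f) = condExpL2 ℂ ℂ P.sigma₂_le (P.lift₁ f) :=
    congrArg Subtype.val (LinearIsometryEquiv.apply_symm_apply P.lift₂.equivRange
      ⟨(condExpL2 ℂ ℂ P.sigma₂_le (P.lift₁ f) : Lp ℂ 2 (normalizedHaar P.Carrier)),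
        P.mem_range_lift₂ _⟩)
  have h2 : AEStronglyMeasurable[P.sigma₂] (P.lift₂ h) (normalizedHaar P.Carrier) :=
    ⟨h ∘ P.proj₂, (Lp.stronglyMeasurable h).comp_measurable (comap_measurable _),
      Lp.coeFn_compMeasurePreserving h P.measurePreserving_proj₂⟩
  rw [← P.lift₂.inner_map_map, h1, ← inner_conj_symm,
    inner_condExpL2_eq_inner_fun P.sigma₂_le _ _ h2, inner_conj_symm]

variable {P}

theorem markovOperator_characterToL2_eq {χ ψ : G →ₜ* Circle}
    (h : P.lift₁ (characterToL2 χ) = P.lift₂ (characterToL2 ψ)) :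
    P.markovOperator (characterToL2 χ) = characterToL2 ψ :=
  ext_inner_left ℂ fun f => by rw [inner_markovOperator, h, P.lift₂.inner_map_map]

variable (P)

theorem markovOperator_characterToL2_one :
    P.markovOperator (characterToL2 1) = characterToL2 1 := by
  refine markovOperator_characterToL2_eq (Lp.ext ?_)
  exact (compMeasurePreserving_characterToL2_ae_eq P.measurePreserving_proj₁ 1).trans
    (compMeasurePreserving_characterToL2_ae_eq P.measurePreserving_proj₂ 1).symm

variable [T2Space G]

/-- The Markov operator maps every character to a character or to `0`. -/
theorem markovOperator_characterToL2 (χ : G →ₜ* Circle) :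
    (∃ ψ : G →ₜ* Circle, P.markovOperator (characterToL2 χ) = characterToL2 ψ) ∨
      P.markovOperator (characterToL2 χ) = 0 := by
  rcases exists_character_or_inner_eq_zero P.continuous_proj₁ P.continuous_proj₂
    P.surjective_proj₂ P.measurePreserving_proj₁ P.measurePreserving_proj₂ χ with ⟨ψ, h⟩ | h
  · exact .inl ⟨ψ, markovOperator_characterToL2_eq h⟩
  · exact .inr (ext_inner_left ℂ fun f => by
      rw [inner_markovOperator, inner_zero_right]; exact h f)

/-- The pullback of a character `ψ` along the second projection is the pullback of a character along
the first one, or `ψ` is orthogonal to the range of the Markov operator. This is the dichotomy of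
`markovOperator_characterToL2` for the adjoint operator. -/
theorem exists_lift₁_eq_lift₂_or (ψ : G →ₜ* Circle) :
    (∃ χ : G →ₜ* Circle, P.lift₁ (characterToL2 χ) = P.lift₂ (characterToL2 ψ)) ∨
      ∀ f, ⟪characterToL2 ψ, P.markovOperator f⟫_ℂ = 0 := by
  rcases exists_character_or_inner_eq_zero P.continuous_proj₂ P.continuous_proj₁
    P.surjective_proj₁ P.measurePreserving_proj₂ P.measurePreserving_proj₁ ψ with ⟨χ, h⟩ | h
  · exact .inl ⟨χ, h.symm⟩
  · refine .inr fun f => ?_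
    rw [inner_markovOperator, ← inner_conj_symm]
    exact (congrArg conj (h f)).trans (map_zero _)

end Correspondence

/-! ### Invariant functions and periodic characters -/

section Constants

variable {G : Type*} [Group G] [TopologicalSpace G] [IsTopologicalGroup G]
    [CompactSpace G] [MeasurableSpace G] [BorelSpace G]

theorem eq_smul_characterToL2_one_iff (f : Lp ℂ 2 (normalizedHaar G)) (c : ℂ) :
    f = c • characterToL2 1 ↔ (f : G → ℂ) =ᵐ[normalizedHaar G] fun _ => c := by
  have h : ((c • characterToL2 (1 : G →ₜ* Circle) : Lp ℂ 2 (normalizedHaar G)) : G → ℂ)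
      =ᵐ[normalizedHaar G] fun _ => c := by
    filter_upwards [Lp.coeFn_smul c (characterToL2 (1 : G →ₜ* Circle)),
      characterToL2_ae_eq (1 : G →ₜ* Circle)] with x h1 h2
    rw [h1, Pi.smul_apply, h2]
    simp
  exact ⟨fun hf => hf ▸ h, fun hf => Lp.ext (hf.trans h.symm)⟩

end Constants

namespace Correspondence

variable {G : Type*} [Group G] [TopologicalSpace G] [IsTopologicalGroup G] [CompactSpace G]
  [T2Space G] [MeasurableSpace G] [BorelSpace G] (P : Correspondence G)

theorem markovOperator_pow_characterToL2 (χ : G →ₜ* Circle) (k : ℕ) :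
    (∃ ψ : G →ₜ* Circle, (P.markovOperator ^ k) (characterToL2 χ) = characterToL2 ψ) ∨
      (P.markovOperator ^ k) (characterToL2 χ) = 0 := by
  induction k with
  | zero => exact .inl ⟨χ, rfl⟩
  | succ k ih =>
    rw [pow_succ', mul_apply_eq_comp]
    rcases ih with ⟨ψ, h⟩ | h
    · rw [h]
      exact P.markovOperator_characterToL2 ψ
    · exact .inr (by rw [h, map_zero])

/-- The sum over a periodic orbit of a nontrivial character `χ` is invariant. It is not constant:
its inner product with `χ` is at least `1`, as each `V ^ k χ` is a character or `0`. -/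
theorem not_isErgodic_of_periodic {χ : G →ₜ* Circle} (hχ : χ ≠ 1) {n : ℕ} (hn : 1 ≤ n)
    (h : (P.markovOperator ^ n) (characterToL2 χ) = characterToL2 χ) : ¬ P.IsErgodic := by
  classical
  intro herg
  let f := ∑ k ∈ Finset.range n, (P.markovOperator ^ k) (characterToL2 χ)
  have hf : P.markovOperator f = f := by
    have h1 : P.markovOperator f =
        ∑ k ∈ Finset.range n, (P.markovOperator ^ (k + 1)) (characterToL2 χ) := by
      rw [map_sum]
      exact Finset.sum_congr rfl fun k _ => by rw [pow_succ', mul_apply_eq_comp]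
    have h2 := Finset.sum_range_succ'
      (fun k => (P.markovOperator ^ k) (characterToL2 χ)) n
    rw [Finset.sum_range_succ, h, ← h1, pow_zero, one_apply_eq_self] at h2
    exact (add_right_cancel h2).symm
  obtain ⟨c, hc⟩ := herg f hf
  have horth := orthonormal_iff_ite.mp (orthonormal_characterToL2 (G := G))
  have hzero : ⟪characterToL2 χ, f⟫_ℂ = 0 := by
    rw [(eq_smul_characterToL2_one_iff f c).mpr hc, inner_smul_right, horth, if_neg hχ, mul_zero]
  have hnonneg : ∀ k, 0 ≤ (⟪characterToL2 χ, (P.markovOperator ^ k) (characterToL2 χ)⟫_ℂ).re := by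
    intro k
    rcases P.markovOperator_pow_characterToL2 χ k with ⟨ψ, h⟩ | h
    · rw [h, horth]
      split_ifs <;> simp
    · rw [h, inner_zero_right, Complex.zero_re]
  have hle : 1 ≤ (⟪characterToL2 χ, f⟫_ℂ).re := by
    rw [inner_sum, Complex.re_sum]
    refine le_trans ?_ (Finset.single_le_sum (fun k _ => hnonneg k)
      (Finset.mem_range.mpr (Nat.lt_of_lt_of_le Nat.zero_lt_one hn)))
    rw [pow_zero, one_apply_eq_self, horth, if_pos rfl, Complex.one_re]
  rw [hzero, Complex.zero_re] at hle
  exact absurd hle (by norm_num)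

/-- A nonzero Fourier coefficient of an invariant function propagates backwards under the Markov
operator, without changing its value. -/
theorem exists_preimage_of_inner_ne_zero {f : Lp ℂ 2 (normalizedHaar G)}
    (hf : P.markovOperator f = f) (ψ : G →ₜ* Circle) (hψ : ⟪characterToL2 ψ, f⟫_ℂ ≠ 0) :
    ∃ χ : G →ₜ* Circle, P.markovOperator (characterToL2 χ) = characterToL2 ψ ∧
      ⟪characterToL2 χ, f⟫_ℂ = ⟪characterToL2 ψ, f⟫_ℂ := by
  rcases P.exists_lift₁_eq_lift₂_or ψ with ⟨χ, h⟩ | h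
  · refine ⟨χ, markovOperator_characterToL2_eq h, ?_⟩
    conv_rhs => rw [← hf, inner_markovOperator, ← h, P.lift₁.inner_map_map]
  · exact absurd (hf ▸ h f) hψ

/-- An invariant function with a nonzero Fourier coefficient at a character `ψ` produces an infinite
backward orbit of characters ending in `ψ`, with the same Fourier coefficient. By Bessel's
inequality the orbit repeats itself. -/
theorem exists_periodic_of_inner_ne_zero {f : Lp ℂ 2 (normalizedHaar G)}
    (hf : P.markovOperator f = f) {ψ : G →ₜ* Circle} (hψ1 : ψ ≠ 1)
    (hψ : ⟪characterToL2 ψ, f⟫_ℂ ≠ 0) :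
    ∃ χ : G →ₜ* Circle, χ ≠ 1 ∧ ∃ n : ℕ, 1 ≤ n ∧
      (P.markovOperator ^ n) (characterToL2 χ) = characterToL2 χ := by
  have hinj := (orthonormal_characterToL2 (G := G)).linearIndependent.injective
  let S := {χ : G →ₜ* Circle // ⟪characterToL2 χ, f⟫_ℂ = ⟪characterToL2 ψ, f⟫_ℂ}
  have hstep : ∀ s : S, ∃ t : S,
      P.markovOperator (characterToL2 t.1) = characterToL2 s.1 := fun s => by
    obtain ⟨χ, h1, h2⟩ := P.exists_preimage_of_inner_ne_zero hf s.1 (s.2.symm ▸ hψ)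
    exact ⟨⟨χ, h2.trans s.2⟩, h1⟩
  choose pre hpre using hstep
  let u : ℕ → S := fun k => pre^[k] ⟨ψ, rfl⟩
  have hu : ∀ j k, (P.markovOperator ^ k) (characterToL2 (u (j + k)).1) =
      characterToL2 (u j).1 := by
    intro j k
    induction k with
    | zero => rfl
    | succ k ih =>
      have h1 : u (j + (k + 1)) = pre (u (j + k)) := Function.iterate_succ_apply' pre (j + k) _
      rw [h1, pow_succ, mul_apply_eq_comp, hpre, ih]
  have hnotinj : ¬ Function.Injective u := by
    intro h
    have h1 := ((orthonormal_characterToL2 (G := G)).comp _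
      (Subtype.val_injective.comp h)).inner_products_summable (x := f)
    have h2 : (fun k : ℕ => ‖⟪(characterToL2 ∘ Subtype.val ∘ u) k, f⟫_ℂ‖ ^ 2) =
        fun _ => ‖⟪characterToL2 ψ, f⟫_ℂ‖ ^ 2 := by
      funext k
      exact congrArg (‖·‖ ^ 2) (u k).2
    rw [h2, summable_const_iff] at h1
    exact hψ (norm_eq_zero.mp (pow_eq_zero_iff two_ne_zero |>.mp h1))
  obtain ⟨j, k, hjk, hlt⟩ : ∃ j k, u j = u k ∧ j < k := by
    rw [Function.not_injective_iff] at hnotinj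
    obtain ⟨j, k, h, hne⟩ := hnotinj
    rcases hne.lt_or_gt with hlt | hlt
    · exact ⟨j, k, h, hlt⟩
    · exact ⟨k, j, h.symm, hlt⟩
  refine ⟨(u j).1, fun h1 => hψ1 ?_, k - j, by omega, ?_⟩
  · -- If `u j` were trivial, so would be its image `ψ` under the `j`-th power of the operator.
    have h2 := hu 0 j
    rw [zero_add, h1] at h2
    have h3 : ∀ m, (P.markovOperator ^ m) (characterToL2 1) = characterToL2 1 := fun m => by
      induction m with
      | zero => rfl
      | succ m ih => rw [pow_succ, mul_apply_eq_comp,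
          markovOperator_characterToL2_one, ih]
    rw [h3] at h2
    exact (hinj h2).symm
  · have h2 := hu j (k - j)
    rwa [Nat.add_sub_cancel' hlt.le, ← hjk] at h2

end Correspondence

/-- By completeness of the characters, an element of `L²(G)` which is not constant has a nonzero
Fourier coefficient at a nontrivial character. -/
theorem exists_inner_characterToL2_ne_zero {G : Type*} [CommGroup G] [TopologicalSpace G]
    [IsTopologicalGroup G] [CompactSpace G] [T2Space G] [MeasurableSpace G] [BorelSpace G]
    {f : Lp ℂ 2 (normalizedHaar G)}
    (hf : ∀ c : ℂ, ¬ (f : G → ℂ) =ᵐ[normalizedHaar G] fun _ => c) :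
    ∃ χ : G →ₜ* Circle, χ ≠ 1 ∧ ⟪characterToL2 χ, f⟫_ℂ ≠ 0 := by
  classical
  by_contra! h
  refine hf _ ((eq_smul_characterToL2_one_iff f ⟪characterToL2 1, f⟫_ℂ).mp (sub_eq_zero.mp
    (eq_zero_of_forall_inner_characterToL2 fun χ => ?_)))
  rw [inner_sub_right, inner_smul_right, orthonormal_iff_ite.mp orthonormal_characterToL2]
  split_ifs with hχ
  · rw [hχ, mul_one, sub_self]
  · rw [h χ hχ, mul_zero, sub_zero]

theorem theorem1p3 {G : Type*} [CommGroup G] [TopologicalSpace G] [IsTopologicalGroup G]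
    [CompactSpace G] [T2Space G] [MeasurableSpace G] [BorelSpace G] (P : Correspondence G) :
    ¬ P.IsErgodic ↔
      ∃ χ : G →ₜ* Circle, χ ≠ 1 ∧ ∃ n : ℕ, 1 ≤ n ∧
        (P.markovOperator ^ n) (characterToL2 χ) = characterToL2 χ := by
  constructor
  · intro h
    rw [Correspondence.IsErgodic] at h
    push Not at h
    obtain ⟨f, hf, hconst⟩ := h
    obtain ⟨ψ, hψ1, hψ⟩ := exists_inner_characterToL2_ne_zero hconst
    exact P.exists_periodic_of_inner_ne_zero hf hψ1 hψ
  · rintro ⟨χ, hχ, n, hn, h⟩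
    exact P.not_isErgodic_of_periodic hχ hn h
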